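/- Consider $n$ parties, labelled by $L=\{1,\dots,n\}$, with finite-dimensional Hilbert spaces $\mathcal H_i=\mathbb C^{d_i}$ of arbitrary dimensions; $\mathcal H_K=\bigotimes_{i\in K}\mathcal H_i$, $\mathcal H=\mathcal H_L$. $\mathcal D(\cdot)$ is the set of density matrices and $\mathcal P(\cdot)$ the set of pure states $|\psi\rangle\langle\psi|$, $\|\psi\|=1$; $\pi_K$ is the partial trace of $\pi$ over $L\setminus K$. For a partition $\alpha=L_1|\dots|L_k$ of $L$ into nonempty blocks, $\mathcal P_\alpha$ is the set of $\alpha$-separable pure states, i.e. of those $|\psi\rangle\langle\psi|$ with $\psi=\bigotimes_r\psi_r$, $\psi_r\in\mathcal H_{L_r}$ unit vectors. Write $\beta\preceq\alpha$ if $\beta$ is finer than or equal to $\alpha$, and let $\mathcal Q_\alpha$ be the set of pure states in $\mathcal P_\alpha$ that lie in no $\mathcal P_\beta$ with $\beta\prec\alpha$. A label $\boldsymbol\alpha$ is any set of partitions of $L$; $\mathcal P_{\boldsymbol\alpha}=\bigcup_{\alpha\in\boldsymbol\alpha}\mathcal P_\alpha$, and the PS (partial separability) subset is $\mathcal D_{\boldsymbol\alpha}=\mathrm{Conv}\,\mathcal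 P_{\boldsymbol\alpha}$. For $g:\mathcal P(\mathcal H)\to\mathbb R$ the convex roof is $g^\cup(\varrho)=\inf\sum_ip_ig(\pi_i)$ over all finite decompositions $\varrho=\sum_ip_i\pi_i$ with $p_i\ge0$, $\sum_i p_i=1$, $\pi_i\in\mathcal P(\mathcal H)$. A continuous $g:\mathcal P(\mathcal H)\to[0,\infty)$ is called a (continuous) $\boldsymbol\alpha$-indicator function if $g(\pi)=0\Leftrightarrow\pi\in\mathcal P_{\boldsymbol\alpha}$. Let $F$ assign to every nonempty $K\subseteq L$ a continuous function $F:\mathcal D(\mathcal H_K)\to[0,\infty)$ that vanishes exactly on the pure states. Put $f_K(\pi)=F(\pi_K)$, $f_\alpha=\sum_{r=1}^kf_{L_r}$ and $f_{\boldsymbol\alpha}=\prod_{\alpha\in\boldsymbol\alpha}f_\alpha$. Then: 1. $\mathcal P_\alpha=\bigcup_{\beta\preceq\alpha}\mathcal Q_\beta$ for every partition $\alpha$; $f_\alpha$ is a continuous $\{\alpha\}$-indicator function, and $f_{\boldsymbol\alpha}$ is a continuous $\boldsymbol\alpha$-indicator function for every label $\boldsymbol\alpha$. 2. For every label $\boldsymbol\alpha$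 and every $\varrho\in\mathcal D(\mathcal H)$ the infimum defining $f_{\boldsymbol\alpha}^\cup(\varrho)$ is attained, and $f_{\boldsymbol\alpha}^\cup(\varrho)=0\Leftrightarrow\varrho\in\mathcal D_{\boldsymbol\alpha}$. The same holds for every continuous $\boldsymbol\alpha$-indicator function $g$ in place of $f_{\boldsymbol\alpha}$. 3. For arbitrary sets $S,T$ of labels, a state $\varrho$ lies in the PS class $\bigcap_{\boldsymbol\alpha\in S}(\mathcal D(\mathcal H)\setminus\mathcal D_{\boldsymbol\alpha})\cap\bigcap_{\boldsymbol\beta\in T}\mathcal D_{\boldsymbol\beta}$ (intersected with $\mathcal D(\mathcal H)$) if and only if $f_{\boldsymbol\alpha}^\cup(\varrho)>0$ for all $\boldsymbol\alpha\in S$ and $f_{\boldsymbol\beta}^\cup(\varrho)=0$ for all $\boldsymbol\beta\in T$. 4. Let $n=3$ and let $a,b,c$ denote distinct parties. The functions $f_{\{1\}}+f_{\{2\}}+f_{\{3\}}$, $f_{\{a\}}$, $f_{\{b\}}f_{\{c\}}$, $f_{\{1\}}f_{\{2\}}f_{\{3\}}$ are continuous indicator functions for the labels $\{1|2|3\}$,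 $\{a|bc\}$, $\{b|ac,\,c|ab\}$, $\{1|23,\,2|13,\,3|12\}$ respectively. Denote the PS subsets of these labels by $D_0$, $B_a$, $R_a$, $D_2$, and $D_1=\mathcal D_{\{123\}}$. Every state lies in exactly one of the twenty sets $\mathcal C_3=D_0$; $\mathcal C_{2.8}=(B_1\cap B_2\cap B_3)\setminus D_0$; $\mathcal C_{2.7.a}=(B_b\cap B_c)\setminus B_a$; $\mathcal C_{2.6.a}=B_a\cap(R_a\setminus(B_b\cup B_c))$; $\mathcal C_{2.5.a}=B_a\setminus R_a$; $\mathcal C_{2.4}=(R_1\cap R_2\cap R_3)\setminus(B_1\cup B_2\cup B_3)$; $\mathcal C_{2.3.a}=(R_b\cap R_c)\setminus(B_a\cup R_a)$; $\mathcal C_{2.2.a}=R_a\setminus(R_b\cup R_c)$; $\mathcal C_{2.1}=D_2\setminus(R_1\cup R_2\cup R_3)$; $\mathcal C_1=D_1\setminus D_2$. A state $\varrho$ lies in a given class if and only if it lies in $D_1$ and, among the eight sets $D_0,B_1,B_2,B_3,R_1,R_2,R_3,D_2$, it belongs to exactly those marked by $0$ in the row of the class below. For any choice of continuous indicator functions for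 the eight labels, this holds if and only if their convex roofs at $\varrho$ vanish for the columns marked $0$ and are positive for the columns marked $+$ (columns in the order $D_0\mid B_a,B_b,B_c\mid R_a,R_b,R_c\mid D_2$): $\mathcal C_3$: $0|000|000|0$; $\mathcal C_{2.8}$: $+|000|000|0$; $\mathcal C_{2.7.a}$: $+|{+}00|000|0$; $\mathcal C_{2.6.a}$: $+|0{+}{+}|000|0$; $\mathcal C_{2.5.a}$: $+|0{+}{+}|{+}00|0$; $\mathcal C_{2.4}$: $+|{+}{+}{+}|000|0$; $\mathcal C_{2.3.a}$: $+|{+}{+}{+}|{+}00|0$; $\mathcal C_{2.2.a}$: $+|{+}{+}{+}|0{+}{+}|0$; $\mathcal C_{2.1}$: $+|{+}{+}{+}|{+}{+}{+}|0$; $\mathcal C_1$: $+|{+}{+}{+}|{+}{+}{+}|+$. -/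

import Mathlib

open scoped ComplexOrder

namespace PartialSep

/-! ### States of finite-dimensional systems -/

section States

variable {ι : Type*} [Fintype ι]

/-- `|ψ⟩⟨ψ|`, where `ψ` is a vector of the Hilbert space `ℂ^ι`. -/
def proj (ψ : ι → ℂ) : Matrix ι ι ℂ := fun x y => ψ x * star (ψ y)

/-- Vectors of norm one: `∑ |ψ x|² = 1`. -/
def IsUnitVec (ψ : ι → ℂ) : Prop := ∑ x, ‖ψ x‖ ^ 2 = 1

/-- The set of (mixed) states: positive semidefinite matrices of trace one. -/
def states (ι : Type*) [Fintype ι] : Set (Matrix ι ι ℂ) :=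
  {ρ | ρ.PosSemidef ∧ ρ.trace = 1}

/-- The set of pure states `|ψ⟩⟨ψ|`, `‖ψ‖ = 1`. -/
def pureStates (ι : Type*) [Fintype ι] : Set (Matrix ι ι ℂ) :=
  {π | ∃ ψ : ι → ℂ, IsUnitVec ψ ∧ π = proj ψ}

/-- The averages `∑ pᵢ f(πᵢ)` over all finite pure-state decompositions `ρ = ∑ pᵢ πᵢ`. -/
def roofValues (f : Matrix ι ι ℂ → ℝ) (ρ : Matrix ι ι ℂ) : Set ℝ :=
  {v | ∃ (m : ℕ) (p : Fin m → ℝ) (π : Fin m → Matrix ι ι ℂ),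
    (∀ i, 0 ≤ p i) ∧ ∑ i, p i = 1 ∧ (∀ i, π i ∈ pureStates ι) ∧
    ∑ i, p i • π i = ρ ∧ v = ∑ i, p i * f (π i)}

/-- The convex roof extension of `f`. -/
noncomputable def convexRoof (f : Matrix ι ι ℂ → ℝ) (ρ : Matrix ι ι ℂ) : ℝ :=
  sInf (roofValues f ρ)

end States

/-! ### Multipartite systems

The parties are labelled by `Fin n`; the party `i` has the Hilbert space `ℂ^(d i)`. -/

section Multipartite

variable {n : ℕ} (d : Fin n → ℕ)

/-- Labels of the product basis of the whole system. -/
abbrev Idx : Type := (i : Fin n) → Fin (d i)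

/-- Labels of the product basis of the subsystem `K`. -/
abbrev SubIdx (K : Finset (Fin n)) : Type := (i : {i // i ∈ K}) → Fin (d i)

variable {d}

/-- Joins a basis label of `K` and one of the complement of `K`. -/
def merge (K : Finset (Fin n)) (x : SubIdx d K) (z : SubIdx d Kᶜ) : Idx d := fun i =>
  if h : i ∈ K then x ⟨i, h⟩ else z ⟨i, Finset.mem_compl.mpr h⟩

/-- The reduced state of the subsystem `K`: the partial trace over the complement of `K`. -/
def reduced (K : Finset (Fin n)) (ρ : Matrix (Idx d) (Idx d) ℂ) :
    Matrix (SubIdx d K) (SubIdx d K) ℂ :=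
  fun x y => ∑ z : SubIdx d Kᶜ, ρ (merge K x z) (merge K y z)

/-- Partitions of the set of parties; `β ≤ α` means that `β` is finer than `α`. -/
abbrev Split (n : ℕ) : Type := Finpartition (Finset.univ : Finset (Fin n))

/-- A label: an arbitrary set of partitions. -/
abbrev PSLabel (n : ℕ) : Type := Finset (Split n)

/-- The vector `⊗_{K ∈ α} φ_K`. -/
def tensorVec (α : Split n) (φ : (K : Finset (Fin n)) → SubIdx d K → ℂ) : Idx d → ℂ :=
  fun x => ∏ K ∈ α.parts, φ K (fun i => x i)

variable (d)

/-- The pure states which are separable under the partition `α`. -/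
def pureSep (α : Split n) : Set (Matrix (Idx d) (Idx d) ℂ) :=
  {π | π ∈ pureStates (Idx d) ∧ ∃ φ : (K : Finset (Fin n)) → SubIdx d K → ℂ,
    (∀ K ∈ α.parts, IsUnitVec (φ K)) ∧ π = proj (tensorVec α φ)}

/-- The pure states separable under `α`, but not under any strictly finer partition. -/
def pureClass (α : Split n) : Set (Matrix (Idx d) (Idx d) ℂ) :=
  {π | π ∈ pureSep d α ∧ ∀ β, β < α → π ∉ pureSep d β}

/-- The pure states separable under some partition belonging to the label `A`. -/
def pureSepLabel (A : PSLabel n) : Set (Matrix (Idx d) (Idx d) ℂ) :=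
  ⋃ α ∈ A, pureSep d α

/-- The PS subset with the label `A`. -/
def psSubset (A : PSLabel n) : Set (Matrix (Idx d) (Idx d) ℂ) :=
  convexHull ℝ (pureSepLabel d A)

/-- The intersection of the PS subsets with labels in `T` and of the complements (in the set of
states) of the PS subsets with labels in `S`. -/
def psClass (S T : Set (PSLabel n)) : Set (Matrix (Idx d) (Idx d) ℂ) :=
  {ρ | ρ ∈ states (Idx d) ∧ (∀ A ∈ S, ρ ∉ psSubset d A) ∧ ∀ B ∈ T, ρ ∈ psSubset d B}

/-- A continuous nonnegative function on the states of every nonempty subsystem, vanishing exactly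
on the pure states. Its values outside of the set of states are irrelevant. -/
def IsMixedness
    (F : (K : Finset (Fin n)) → Matrix (SubIdx d K) (SubIdx d K) ℂ → ℝ) : Prop :=
  ∀ K : Finset (Fin n), K.Nonempty →
    ContinuousOn (F K) (states (SubIdx d K)) ∧
    (∀ ρ ∈ states (SubIdx d K), 0 ≤ F K ρ) ∧
    ∀ ρ ∈ states (SubIdx d K), (F K ρ = 0 ↔ ρ ∈ pureStates (SubIdx d K))

/-- `g` is a continuous `A`-indicator function: it is nonnegative on the pure states, and vanishes
exactly on those which are separable under some partition belonging to `A`. -/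
def IsIndicator (A : PSLabel n) (g : Matrix (Idx d) (Idx d) ℂ → ℝ) : Prop :=
  ContinuousOn g (pureStates (Idx d)) ∧
  (∀ π ∈ pureStates (Idx d), 0 ≤ g π) ∧
  ∀ π ∈ pureStates (Idx d), (g π = 0 ↔ π ∈ pureSepLabel d A)

variable {d}

/-- `f_K(π) = F(π_K)`. -/
def indK (F : (K : Finset (Fin n)) → Matrix (SubIdx d K) (SubIdx d K) ℂ → ℝ)
    (K : Finset (Fin n)) (π : Matrix (Idx d) (Idx d) ℂ) : ℝ :=
  F K (reduced K π)

/-- The sum of `f_K` over the blocks `K` of the partition `α`. -/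
def indSplit (F : (K : Finset (Fin n)) → Matrix (SubIdx d K) (SubIdx d K) ℂ → ℝ)
    (α : Split n) (π : Matrix (Idx d) (Idx d) ℂ) : ℝ :=
  ∑ K ∈ α.parts, indK F K π

/-- The product of the `f_α` over the partitions `α` belonging to the label `A`. -/
def indLabel (F : (K : Finset (Fin n)) → Matrix (SubIdx d K) (SubIdx d K) ℂ → ℝ)
    (A : PSLabel n) (π : Matrix (Idx d) (Idx d) ℂ) : ℝ :=
  ∏ α ∈ A, indSplit F α π

end Multipartite

/-! ### Tripartite systems

For `a : Fin 3`, the other two parties are `b = a + 1` and `c = a + 2`. -/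

section Tripartite

/-- The partition `a|bc`. -/
def biSplit (a : Fin 3) : Split 3 where
  parts := {{a}, {a + 1, a + 2}}
  supIndep := by revert a; decide
  sup_parts := by revert a; decide
  bot_notMem := by revert a; decide

/-- The nontrivial labels for three parties. -/
inductive TriLabel
  /-- `1|2|3` -/
  | full
  /-- `a|bc` -/
  | bi (a : Fin 3)
  /-- `b|ac, c|ab` -/
  | pair (a : Fin 3)
  /-- `1|23, 2|13, 3|12` -/
  | two

/-- The set of partitions given by a tripartite label. -/
def TriLabel.label : TriLabel → PSLabel 3
  | .full => {⊥}
  | .bi a => {biSplit a}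
  | .pair a => {biSplit (a + 1), biSplit (a + 2)}
  | .two => {biSplit 0, biSplit 1, biSplit 2}

variable {d : Fin 3 → ℕ}

/-- Tripartite indicator functions built from the one-party reduced states only. -/
def triInd (F : (K : Finset (Fin 3)) → Matrix (SubIdx d K) (SubIdx d K) ℂ → ℝ)
    (π : Matrix (Idx d) (Idx d) ℂ) : TriLabel → ℝ
  | .full => indK F {0} π + indK F {1} π + indK F {2} π
  | .bi a => indK F {a} π
  | .pair a => indK F {a + 1} π * indK F {a + 2} π
  | .two => indK F {0} π * indK F {1} π * indK F {2} π

variable (d)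

/-- The PS subset of a tripartite label. -/
def triD (t : TriLabel) : Set (Matrix (Idx d) (Idx d) ℂ) := psSubset d t.label

/-- Names of the twenty PS classes of tripartite mixed states. -/
inductive TriClass
  | c3
  | c28
  | c27 (a : Fin 3)
  | c26 (a : Fin 3)
  | c25 (a : Fin 3)
  | c24
  | c23 (a : Fin 3)
  | c22 (a : Fin 3)
  | c21
  | c1

open TriLabel in
/-- The PS classes of tripartite mixed states. -/
def triClass : TriClass → Set (Matrix (Idx d) (Idx d) ℂ)
  | .c3 => triD d full
  | .c28 => (triD d (bi 0) ∩ triD d (bi 1) ∩ triD d (bi 2)) \ triD d full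
  | .c27 a => (triD d (bi (a + 1)) ∩ triD d (bi (a + 2))) \ triD d (bi a)
  | .c26 a => triD d (bi a) ∩
      (triD d (pair a) \ (triD d (bi (a + 1)) ∪ triD d (bi (a + 2))))
  | .c25 a => triD d (bi a) \ triD d (pair a)
  | .c24 => (triD d (pair 0) ∩ triD d (pair 1) ∩ triD d (pair 2)) \
      (triD d (bi 0) ∪ triD d (bi 1) ∪ triD d (bi 2))
  | .c23 a => (triD d (pair (a + 1)) ∩ triD d (pair (a + 2))) \
      (triD d (bi a) ∪ triD d (pair a))
  | .c22 a => triD d (pair a) \ (triD d (pair (a + 1)) ∪ triD d (pair (a + 2)))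
  | .c21 => triD d two \ (triD d (pair 0) ∪ triD d (pair 1) ∪ triD d (pair 2))
  | .c1 => psSubset d {⊤} \ triD d two

/-- The table of the PS classes: whether the class in the row is contained in the PS subset in the
column (equivalently, has the value zero there), or is disjoint from it. -/
def triTable : TriClass → TriLabel → Prop
  | .c3, _ => True
  | .c1, _ => False
  | _, .full => False
  | _, .two => True
  | .c28, .bi _ => True
  | .c28, .pair _ => True
  | .c27 a, .bi x => x ≠ a
  | .c27 _, .pair _ => True
  | .c26 a, .bi x => x = a
  | .c26 _, .pair _ => True
  | .c25 a, .bi x => x = a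
  | .c25 a, .pair x => x ≠ a
  | .c24, .bi _ => False
  | .c24, .pair _ => True
  | .c23 _, .bi _ => False
  | .c23 a, .pair x => x ≠ a
  | .c22 _, .bi _ => False
  | .c22 a, .pair x => x = a
  | .c21, .bi _ => False
  | .c21, .pair _ => False

end Tripartite

end PartialSep

open PartialSep

namespace PartialSep

/-! ### Convex hulls in finite dimension -/

section ConvexHull

variable {E : Type*} [AddCommGroup E] [Module ℝ E]

/-! Two facts carry the theorem. First, the reduction of |ψ⟩⟨ψ| to K is pure exactly when ψ is a
product across K and its complement (`reduced_mem_pureStates_iff`). `Splits` expresses the latter by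
two-by-two minors, which needs no choice of factors and is visibly stable under scaling ψ and under
complementing K. Splitting along each block separately already gives a full tensor product over the
blocks (`eq_smul_tensorVec`), so the sum f_α of nonnegative terms vanishes exactly on the
α-separable pure states, and a product of such sums vanishes exactly on the union over the label.

Second, the values averaged in a convex roof at ρ form the fibre over ρ of the convex hull of the
graph of g. The graph is compact, and by Carathéodory so is its hull; hence the infimum is attained.
An attained value zero is a decomposition of ρ into zeros of g, which is membership in the PS subset
(`convexRoof_eq_zero_iff`).

The class statements translate this equivalence. For three parties the rest is propositional logic
from the inclusions D_0 ⊆ B_a ⊆ R_b ⊆ D_2 for a ≠ b. -/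

open Module in
/-- Carathéodory's theorem with a fixed number of (possibly repeated) points. -/
theorem exists_fin_of_mem_convexHull [FiniteDimensional ℝ E] {s : Set E} {x : E}
    (hx : x ∈ convexHull ℝ s) :
    ∃ (p : Fin (finrank ℝ E + 1) → ℝ) (z : Fin (finrank ℝ E + 1) → E),
      (∀ i, 0 ≤ p i) ∧ ∑ i, p i = 1 ∧ (∀ i, z i ∈ s) ∧ ∑ i, p i • z i = x := by
  obtain ⟨ι, _, z, w, hz, hind, hw, hsum, rfl⟩ := eq_pos_convex_span_of_mem_convexHull hx
  obtain ⟨z₀, hz₀⟩ : s.Nonempty := convexHull_nonempty_iff.1 ⟨_, hx⟩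
  have hcard : Fintype.card ι ≤ Fintype.card (Fin (finrank ℝ E + 1)) := by
    rw [Fintype.card_fin]
    exact hind.card_le_finrank_succ.trans
      (Nat.succ_le_succ (Submodule.finrank_le _))
  obtain ⟨e⟩ := Function.Embedding.nonempty_of_card_le hcard
  have hout : ∀ j, j ∉ Set.range e → Function.extend e w 0 j = 0 := fun j hj =>
    Function.extend_apply' _ _ _ hj
  -- The affinely independent family may be shorter than the dimension plus one; it is padded with
  -- weight zero at an arbitrary point `z₀` of `s`.
  refine ⟨Function.extend e w 0, Function.extend e z fun _ => z₀, fun j => ?_, ?_, fun j => ?_, ?_⟩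
  · by_cases hj : j ∈ Set.range e
    · obtain ⟨i, rfl⟩ := hj
      rw [e.injective.extend_apply]
      exact (hw i).le
    · exact (hout j hj).ge
  · rw [← hsum]
    exact (Fintype.sum_of_injective e e.injective _ _ hout
      fun i => (e.injective.extend_apply _ _ _).symm).symm
  · by_cases hj : j ∈ Set.range e
    · obtain ⟨i, rfl⟩ := hj
      rw [e.injective.extend_apply]
      exact hz ⟨i, rfl⟩
    · rw [Function.extend_apply' _ _ _ hj]
      exact hz₀
  · refine (Fintype.sum_of_injective e e.injective _ _ (fun j hj => ?_) fun i => ?_).symm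
    · rw [hout j hj, zero_smul]
    · rw [e.injective.extend_apply, e.injective.extend_apply]

/-- Points of weight zero may lie outside `s`. This slack is needed for convex roofs: a minimal
decomposition says nothing about `g` on states of weight zero. -/
theorem sum_smul_mem_convexHull {ι : Type*} [Fintype ι] {s : Set E} {p : ι → ℝ} {z : ι → E}
    (hp : ∀ i, 0 ≤ p i) (hp1 : ∑ i, p i = 1) (hz : ∀ i, p i ≠ 0 → z i ∈ s) :
    ∑ i, p i • z i ∈ convexHull ℝ s := by
  classical
  have h := Finset.centerMass_mem_convexHull (R := ℝ) (s := s) (Finset.univ.filter (p · ≠ 0))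
    (fun i _ => hp i) (w := p) (by rw [Finset.sum_filter_ne_zero, hp1]; exact one_pos)
    (z := z) (fun i hi => hz i (Finset.mem_filter.1 hi).2)
  rwa [Finset.centerMass_filter_ne_zero, Finset.centerMass_eq_of_sum_1 _ _ hp1] at h

/-- The fixed number of points in Carathéodory's theorem makes the hull a continuous image of a
simplex times a finite power of `s`. -/
theorem isCompact_convexHull_of_isCompact [FiniteDimensional ℝ E] [TopologicalSpace E]
    [ContinuousAdd E] [ContinuousSMul ℝ E] {s : Set E} (hs : IsCompact s) :
    IsCompact (convexHull ℝ s) := by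
  set N := Module.finrank ℝ E + 1
  have hK : IsCompact (stdSimplex ℝ (Fin N) ×ˢ Set.univ.pi fun _ : Fin N => s) :=
    (isCompact_stdSimplex ℝ _).prod (isCompact_univ_pi fun _ => hs)
  have hc : Continuous fun q : (Fin N → ℝ) × (Fin N → E) => ∑ i, q.1 i • q.2 i := by fun_prop
  convert! hK.image hc
  ext x
  constructor
  · intro hx
    obtain ⟨p, z, hp, hp1, hz, rfl⟩ := exists_fin_of_mem_convexHull hx
    exact ⟨(p, z), ⟨⟨hp, hp1⟩, fun i _ => hz i⟩, rfl⟩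
  · rintro ⟨⟨p, z⟩, ⟨⟨hp, hp1⟩, hz⟩, rfl⟩
    exact sum_smul_mem_convexHull hp hp1 fun i _ => hz i trivial

end ConvexHull

/-! ### Pure states and convex roofs -/

section Roof

variable {ι : Type*} [Fintype ι]

theorem trace_proj (ψ : ι → ℂ) : (proj ψ).trace = ((∑ x, ‖ψ x‖ ^ 2 : ℝ) : ℂ) := by
  simp [Matrix.trace, proj, Complex.mul_conj, Complex.normSq_eq_norm_sq]

theorem posSemidef_proj (ψ : ι → ℂ) : (proj ψ).PosSemidef :=
  Matrix.posSemidef_vecMulVec_self_star ψ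

theorem isUnitVec_iff_trace (ψ : ι → ℂ) : IsUnitVec ψ ↔ (proj ψ).trace = 1 := by
  rw [trace_proj, IsUnitVec]
  norm_cast

theorem IsUnitVec.exists_ne_zero {ψ : ι → ℂ} (h : IsUnitVec ψ) : ∃ x, ψ x ≠ 0 := by
  by_contra! h0
  simp [IsUnitVec, h0] at h

theorem pureStates_subset_states : pureStates ι ⊆ states ι := by
  rintro _ ⟨ψ, hψ, rfl⟩
  exact ⟨posSemidef_proj ψ, (isUnitVec_iff_trace ψ).1 hψ⟩

theorem convex_states : Convex ℝ (states ι) := by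
  rintro ρ ⟨hρ, hρ1⟩ σ ⟨hσ, hσ1⟩ a b ha hb hab
  refine ⟨(hρ.smul ha).add (hσ.smul hb), ?_⟩
  rw [Matrix.trace_add, Matrix.trace_smul, Matrix.trace_smul, hρ1, hσ1, ← add_smul, hab, one_smul]

theorem isCompact_pureStates : IsCompact (pureStates ι) := by
  have hK : IsCompact {ψ : ι → ℂ | IsUnitVec ψ} := by
    refine Metric.isCompact_of_isClosed_isBounded ?_ ?_
    · exact isClosed_eq (by fun_prop) continuous_const
    · refine (Metric.isBounded_closedBall (x := (0 : ι → ℂ)) (r := 1)).subset fun ψ hψ => ?_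
      -- The norm of `ι → ℂ` is the sup norm, so it suffices to bound each coordinate.
      rw [mem_closedBall_zero_iff, pi_norm_le_iff_of_nonneg zero_le_one]
      intro x
      have h : ‖ψ x‖ ^ 2 ≤ 1 := by
        rw [← show ∑ x, ‖ψ x‖ ^ 2 = 1 from hψ]
        exact Finset.single_le_sum (f := fun x => ‖ψ x‖ ^ 2) (fun _ _ => by positivity)
          (Finset.mem_univ x)
      exact (sq_le_one_iff₀ (norm_nonneg _)).1 h
  have hc : Continuous (proj : (ι → ℂ) → Matrix ι ι ℂ) :=
    continuous_pi fun x => continuous_pi fun y => by unfold proj; fun_prop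
  convert! hK.image hc
  ext π
  simp only [pureStates, Set.mem_ofPred_eq, Set.mem_image, eq_comm]

/-- The spectral decomposition writes a state as a mixture of its eigenprojections, weighted by the
eigenvalues. -/
theorem convexHull_pureStates : convexHull ℝ (pureStates ι) = states ι := by
  classical
  refine (convexHull_min pureStates_subset_states convex_states).antisymm ?_
  rintro ρ ⟨hρ, hρ1⟩
  set U := hρ.1.eigenvectorUnitary
  have hdec : ρ = ∑ i, hρ.1.eigenvalues i • proj fun x => (U : Matrix ι ι ℂ) x i := by
    conv_lhs => rw [hρ.1.spectral_theorem]
    ext x y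
    simp [Unitary.conjStarAlgAut_apply, Matrix.mul_apply, Matrix.sum_apply, proj,
      Matrix.diagonal_apply, U]
    refine Finset.sum_congr rfl fun i _ => by ring
  rw [hdec]
  refine sum_smul_mem_convexHull hρ.eigenvalues_nonneg ?_ fun i _ => ⟨_, ?_, rfl⟩
  · have := hρ.1.trace_eq_sum_eigenvalues
    rw [hρ1] at this
    exact Complex.ofReal_injective (by simpa using this.symm)
  · have := congrFun (congrFun (Unitary.coe_star_mul_self U) i) i
    simp only [Matrix.mul_apply, Matrix.star_apply, Matrix.one_apply_eq, RCLike.star_def,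
      Complex.conj_mul'] at this
    unfold IsUnitVec
    exact_mod_cast this

variable {g : Matrix ι ι ℂ → ℝ} {ρ : Matrix ι ι ℂ}

/-- Passing to the graph of `g` lets Carathéodory bound the length of a decomposition while keeping
both the state and the averaged value. -/
theorem mem_roofValues_iff (v : ℝ) :
    v ∈ roofValues g ρ ↔ (ρ, v) ∈ convexHull ℝ ((fun π => (π, g π)) '' pureStates ι) := by
  constructor
  · rintro ⟨m, p, π, hp, hp1, hπ, rfl, rfl⟩
    have h := sum_smul_mem_convexHull (s := (fun π => (π, g π)) '' pureStates ι)
      (z := fun i => (π i, g (π i))) hp hp1 fun i _ => ⟨_, hπ i, rfl⟩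
    have hsum : ∑ i, p i • (π i, g (π i)) = (∑ i, p i • π i, ∑ i, p i * g (π i)) :=
      Prod.ext (by simp [Prod.fst_sum]) (by simp [Prod.snd_sum])
    rwa [hsum] at h
  · intro h
    obtain ⟨p, z, hp, hp1, hz, hsum⟩ := exists_fin_of_mem_convexHull h
    choose π hπ hz using hz
    obtain rfl : (fun i => (π i, g (π i))) = z := funext hz
    refine ⟨_, p, π, hp, hp1, hπ, ?_, ?_⟩
    · simpa [Prod.fst_sum] using congrArg Prod.fst hsum
    · simpa [Prod.snd_sum] using (congrArg Prod.snd hsum).symm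

theorem roofValues_nonempty (hρ : ρ ∈ states ι) : (roofValues g ρ).Nonempty := by
  rw [← convexHull_pureStates] at hρ
  obtain ⟨p, z, hp, hp1, hz, hsum⟩ := exists_fin_of_mem_convexHull hρ
  exact ⟨_, _, p, z, hp, hp1, hz, hsum, rfl⟩

theorem isCompact_roofValues (hg : ContinuousOn g (pureStates ι)) :
    IsCompact (roofValues g ρ) := by
  have hK := isCompact_convexHull_of_isCompact
    (isCompact_pureStates.image_of_continuousOn (continuousOn_id.prodMk hg))
  convert! (hK.inter_right (isClosed_singleton.preimage continuous_fst (t := {ρ}))).image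
    continuous_snd
  ext v
  rw [mem_roofValues_iff]
  constructor
  · exact fun h => ⟨_, ⟨h, rfl⟩, rfl⟩
  · rintro ⟨⟨_, _⟩, ⟨h, rfl⟩, rfl⟩
    exact h

theorem isLeast_convexRoof (hg : ContinuousOn g (pureStates ι)) (hρ : ρ ∈ states ι) :
    IsLeast (roofValues g ρ) (convexRoof g ρ) :=
  (isCompact_roofValues hg).isLeast_sInf (roofValues_nonempty hρ)

theorem convexRoof_nonneg (hg : ∀ π ∈ pureStates ι, 0 ≤ g π) : 0 ≤ convexRoof g ρ := by
  refine Real.sInf_nonneg ?_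
  rintro _ ⟨m, p, π, hp, -, hπ, -, rfl⟩
  exact Finset.sum_nonneg fun i _ => mul_nonneg (hp i) (hg _ (hπ i))

theorem convexRoof_eq_zero_iff (hg : ContinuousOn g (pureStates ι))
    (hg0 : ∀ π ∈ pureStates ι, 0 ≤ g π) (hρ : ρ ∈ states ι) :
    convexRoof g ρ = 0 ↔ ρ ∈ convexHull ℝ {π ∈ pureStates ι | g π = 0} := by
  have hleast := isLeast_convexRoof hg hρ
  constructor
  · intro h
    obtain ⟨m, p, π, hp, hp1, hπ, hsum, hv⟩ := hleast.1
    rw [h, eq_comm, Finset.sum_eq_zero_iff_of_nonneg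
      fun i _ => mul_nonneg (hp i) (hg0 _ (hπ i))] at hv
    rw [← hsum]
    exact sum_smul_mem_convexHull hp hp1 fun i hi =>
      ⟨hπ i, (mul_eq_zero.1 (hv i (Finset.mem_univ i))).resolve_left hi⟩
  · intro h
    obtain ⟨p, z, hp, hp1, hz, hsum⟩ := exists_fin_of_mem_convexHull h
    refine le_antisymm (hleast.2 ⟨_, p, z, hp, hp1, fun i => (hz i).1, hsum, ?_⟩)
      (convexRoof_nonneg hg0)
    exact (Finset.sum_eq_zero fun i _ => by rw [(hz i).2, mul_zero]).symm

end Roof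

/-! ### Product vectors -/

section Splitting

variable {n : ℕ} {d : Fin n → ℕ}

/-- `ψ` is a product vector with respect to `K` and its complement, expressed by the vanishing of
the two-by-two minors. -/
def Splits (K : Finset (Fin n)) (ψ : Idx d → ℂ) : Prop :=
  ∀ x y, ψ x * ψ y = ψ (K.piecewise x y) * ψ (K.piecewise y x)

theorem splits_compl {K : Finset (Fin n)} {ψ : Idx d → ℂ} : Splits Kᶜ ψ ↔ Splits K ψ := by
  simp only [Splits, Finset.piecewise_compl, mul_comm]

theorem splits_univ (ψ : Idx d → ℂ) : Splits Finset.univ ψ := fun x y => by simp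

theorem Splits.smul {K : Finset (Fin n)} {ψ : Idx d → ℂ} (h : Splits K ψ) (c : ℂ) :
    Splits K (c • ψ) := fun x y => by
  simp only [Pi.smul_apply, smul_eq_mul]
  linear_combination c ^ 2 * h x y

theorem exists_smul_eq_of_proj_eq {ι : Type*} {ψ χ : ι → ℂ} (h : proj ψ = proj χ) :
    ∃ c : ℂ, ψ = c • χ := by
  by_cases h0 : ∃ x, ψ x ≠ 0
  · obtain ⟨x, hx⟩ := h0
    -- The scalar is read off the column at `x` of the two projections.
    refine ⟨star (χ x) / star (ψ x), funext fun y => ?_⟩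
    have := congrFun (congrFun h y) x
    simp only [proj] at this
    have hx' : star (ψ x) ≠ 0 := star_ne_zero.2 hx
    rw [Pi.smul_apply, smul_eq_mul]
    field_simp
    linear_combination this
  · push Not at h0
    exact ⟨0, funext fun x => by simp [h0 x]⟩

theorem splits_of_proj_eq {K : Finset (Fin n)} {ψ χ : Idx d → ℂ} (h : proj ψ = proj χ)
    (hχ : Splits K χ) : Splits K ψ := by
  obtain ⟨c, rfl⟩ := exists_smul_eq_of_proj_eq h
  exact hχ.smul c

/-! ### Reduced states -/

/-- The splitting of basis labels into those of `K` and those of its complement. -/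
def mergeEquiv (K : Finset (Fin n)) : SubIdx d K × SubIdx d Kᶜ ≃ Idx d where
  toFun p := merge K p.1 p.2
  invFun x := (fun i => x i, fun i => x i)
  left_inv p := by
    refine Prod.ext (funext fun i => ?_) (funext fun i => ?_)
    · simp [merge, i.2]
    · simp [merge, Finset.mem_compl.1 i.2]
  right_inv x := by
    funext i
    simp [merge]

theorem sum_merge (K : Finset (Fin n)) (f : Idx d → ℂ) :
    ∑ x, ∑ z, f (merge K x z) = ∑ x, f x := by
  rw [← (mergeEquiv K).sum_comp f, Fintype.sum_prod_type]
  rfl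

theorem piecewise_merge (K : Finset (Fin n)) (x y : SubIdx d K) (z w : SubIdx d Kᶜ) :
    K.piecewise (merge K x z) (merge K y w) = merge K x w := by
  funext i
  by_cases h : i ∈ K <;> simp [merge, h]

theorem trace_reduced (K : Finset (Fin n)) (ρ : Matrix (Idx d) (Idx d) ℂ) :
    (reduced K ρ).trace = ρ.trace :=
  sum_merge K fun x => ρ x x

theorem reduced_mem_states (K : Finset (Fin n)) {ρ : Matrix (Idx d) (Idx d) ℂ}
    (hρ : ρ ∈ states (Idx d)) : reduced K ρ ∈ states (SubIdx d K) := by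
  refine ⟨?_, (trace_reduced K ρ).trans hρ.2⟩
  have h : reduced K ρ = ∑ z, ρ.submatrix (merge K · z) (merge K · z) := by
    ext x y
    simp [reduced, Matrix.sum_apply]
  rw [h]
  exact Matrix.posSemidef_sum _ fun z _ => hρ.1.submatrix _

theorem continuous_reduced (K : Finset (Fin n)) :
    Continuous (reduced K : Matrix (Idx d) (Idx d) ℂ → _) := by
  refine continuous_pi fun x => continuous_pi fun y => ?_
  unfold reduced
  exact continuous_finsetSum _ fun z _ => continuous_apply_apply _ _

/-- If the reduced state is pure, then the vector is a product. -/
theorem splits_of_reduced_mem_pureStates {K : Finset (Fin n)} {ψ : Idx d → ℂ}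
    (h : reduced K (proj ψ) ∈ pureStates (SubIdx d K)) : Splits K ψ := by
  obtain ⟨χ, hχ, hred⟩ := h
  -- Reshaping `ψ` into a matrix with rows in `K` and columns in the complement turns the partial
  -- trace into `M * Mᴴ`.
  let M : Matrix (SubIdx d K) (SubIdx d Kᶜ) ℂ := fun x z => ψ (merge K x z)
  have hM : M * M.conjTranspose = proj χ := by
    rw [← hred]
    rfl
  have hχ2 : proj χ * proj χ = proj χ := by
    have hs : ∑ i, star (χ i) * χ i = 1 := by
      have h1 := (isUnitVec_iff_trace χ).1 hχ
      rw [← h1]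
      exact Finset.sum_congr rfl fun i _ => mul_comm _ _
    ext x y
    calc ∑ i, χ x * star (χ i) * (χ i * star (χ y))
        = χ x * star (χ y) * ∑ i, star (χ i) * χ i := by
          rw [Finset.mul_sum]
          exact Finset.sum_congr rfl fun i _ => by ring
      _ = χ x * star (χ y) := by rw [hs, mul_one]
  -- With P = `proj χ` and A = (1 - P)M, A Aᴴ = (1 - P)P(1 - P)ᴴ = 0. Hence M = P M, so every column
  -- of `M` is a multiple of `χ`.
  have h0 : (1 - proj χ) * M = 0 := by
    rw [← Matrix.self_mul_conjTranspose_eq_zero, Matrix.conjTranspose_mul, Matrix.mul_assoc,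
      ← Matrix.mul_assoc M, hM, ← Matrix.mul_assoc, Matrix.sub_mul, Matrix.one_mul, hχ2, sub_self,
      Matrix.zero_mul]
  have hψ : ∀ x z, ψ (merge K x z) = χ x * ∑ y, star (χ y) * ψ (merge K y z) := by
    intro x z
    rw [Matrix.sub_mul, Matrix.one_mul, sub_eq_zero] at h0
    calc ψ (merge K x z) = (proj χ * M) x z := congrFun (congrFun h0 x) z
      _ = _ := by
        rw [Finset.mul_sum]
        exact Finset.sum_congr rfl fun i _ => mul_assoc _ _ _
  intro x y
  obtain ⟨⟨x, z⟩, rfl⟩ := (mergeEquiv K).surjective x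
  obtain ⟨⟨y, w⟩, rfl⟩ := (mergeEquiv K).surjective y
  change ψ (merge K x z) * ψ (merge K y w) = ψ (K.piecewise (merge K x z) (merge K y w)) *
    ψ (K.piecewise (merge K y w) (merge K x z))
  rw [piecewise_merge, piecewise_merge, hψ x z, hψ y w, hψ x w, hψ y z]
  ring

theorem reduced_mem_pureStates_of_splits {K : Finset (Fin n)} {ψ : Idx d → ℂ}
    (hψ : IsUnitVec ψ) (h : Splits K ψ) : reduced K (proj ψ) ∈ pureStates (SubIdx d K) := by
  obtain ⟨x₀, hx₀⟩ := hψ.exists_ne_zero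
  obtain ⟨⟨a, b⟩, rfl⟩ := (mergeEquiv K).surjective x₀
  change ψ (merge K a b) ≠ 0 at hx₀
  -- The minor through the nonzero entry `(a, b)` factorizes `ψ`; the squared norm `s` of the
  -- complementary factor is what the partial trace leaves.
  have hprod : ∀ x z, ψ (merge K x z) = ψ (merge K x b) * (ψ (merge K a z) / ψ (merge K a b)) := by
    intro x z
    have := h (merge K x z) (merge K a b)
    rw [piecewise_merge, piecewise_merge] at this
    field_simp
    exact this
  set s : ℝ := ∑ z, ‖ψ (merge K a z) / ψ (merge K a b)‖ ^ 2 with hs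
  have hs0 : 0 ≤ s := Finset.sum_nonneg fun _ _ => by positivity
  have hs2 : (Real.sqrt s : ℂ) * Real.sqrt s = s := by
    rw [← Complex.ofReal_mul, Real.mul_self_sqrt hs0]
  have hred : reduced K (proj ψ) = proj fun x => (Real.sqrt s : ℂ) * ψ (merge K x b) := by
    ext x y
    have hz : ∀ z, ψ (merge K x z) * star (ψ (merge K y z)) = ψ (merge K x b) *
        star (ψ (merge K y b)) * ((‖ψ (merge K a z) / ψ (merge K a b)‖ ^ 2 : ℝ) : ℂ) := by
      intro z
      rw [hprod x z, hprod y z, star_mul', ← Complex.normSq_eq_norm_sq, ← Complex.mul_conj,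
        starRingEnd_apply]
      ring
    calc ∑ z, ψ (merge K x z) * star (ψ (merge K y z))
        = ψ (merge K x b) * star (ψ (merge K y b)) * (s : ℂ) := by
          rw [Finset.sum_congr rfl fun z _ => hz z, ← Finset.mul_sum, hs, Complex.ofReal_sum]
      _ = _ := by
          simp only [proj, star_mul', RCLike.star_def, Complex.conj_ofReal]
          rw [← hs2]
          ring
  refine ⟨_, ?_, hred⟩
  -- Normalization is inherited from `ψ`, because the partial trace preserves the trace.
  rw [isUnitVec_iff_trace, ← hred, trace_reduced, ← isUnitVec_iff_trace]
  exact hψ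

theorem reduced_mem_pureStates_iff {K : Finset (Fin n)} {ψ : Idx d → ℂ} (hψ : IsUnitVec ψ) :
    reduced K (proj ψ) ∈ pureStates (SubIdx d K) ↔ Splits K ψ :=
  ⟨splits_of_reduced_mem_pureStates, reduced_mem_pureStates_of_splits hψ⟩

/-! ### Separable pure states -/

/-- Basis labels of the whole system as families of basis labels of the blocks. -/
def blockEquiv (α : Split n) : Idx d ≃ ((K : α.parts) → SubIdx d K.1) where
  toFun x _ i := x i
  invFun y i := y ⟨α.part i, α.part_mem.2 (Finset.mem_univ i)⟩
    ⟨i, α.mem_part_self.2 (Finset.mem_univ i)⟩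
  left_inv _ := rfl
  right_inv y := by
    funext ⟨K, hK⟩ ⟨i, hi⟩
    obtain rfl := α.part_eq_of_mem hK hi
    rfl

theorem sum_norm_tensorVec (α : Split n) (φ : (K : Finset (Fin n)) → SubIdx d K → ℂ) :
    ∑ x, ‖tensorVec α φ x‖ ^ 2 = ∏ K ∈ α.parts, ∑ x, ‖φ K x‖ ^ 2 := by
  rw [← Finset.prod_coe_sort, Fintype.prod_sum, ← (blockEquiv α).sum_comp]
  refine Finset.sum_congr rfl fun x _ => ?_
  rw [tensorVec, norm_prod, ← Finset.prod_pow, ← Finset.prod_coe_sort]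
  rfl

/-- Exchanging the coordinates in `U` either swaps the two arguments of a factor or leaves them
alone, so the product is unchanged. -/
theorem splits_tensorVec {α : Split n} (φ : (K : Finset (Fin n)) → SubIdx d K → ℂ)
    {U : Finset (Fin n)} (hU : ∀ K ∈ α.parts, K ⊆ U ∨ Disjoint K U) :
    Splits U (tensorVec α φ) := by
  intro x y
  simp only [tensorVec, ← Finset.prod_mul_distrib]
  refine Finset.prod_congr rfl fun K hK => ?_
  rcases hU K hK with h | h
  · have h1 : ∀ x y : Idx d, (fun i : {i // i ∈ K} => U.piecewise x y i) =
        fun i : {i // i ∈ K} => x i :=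
      fun x y => funext fun i => U.piecewise_eq_of_mem _ _ (h i.2)
    rw [h1, h1]
  · have h1 : ∀ x y : Idx d, (fun i : {i // i ∈ K} => U.piecewise x y i) =
        fun i : {i // i ∈ K} => y i :=
      fun x y => funext fun i => U.piecewise_eq_of_notMem _ _ (Finset.disjoint_left.1 h i.2)
    rw [h1, h1, mul_comm]

theorem subset_or_disjoint_of_le {α β : Split n} (h : β ≤ α) {U : Finset (Fin n)}
    (hU : U ∈ α.parts) : ∀ K ∈ β.parts, K ⊆ U ∨ Disjoint K U := by
  intro K hK
  obtain ⟨V, hV, hKV⟩ := h hK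
  by_cases hUV : V = U
  · exact .inl (hUV ▸ hKV)
  · exact .inr ((α.disjoint hV hU hUV).mono_left hKV)

/-- The factors of a product vector are its sections through a fixed basis label. -/
theorem eq_smul_tensorVec {α : Split n} {ψ : Idx d → ℂ} (h : ∀ K ∈ α.parts, Splits K ψ)
    {x₀ : Idx d} (hx₀ : ψ x₀ ≠ 0) :
    ψ = ψ x₀ • tensorVec α fun K x => ψ (merge K x fun i => x₀ i) / ψ x₀ := by
  have hmerge : ∀ (K : Finset (Fin n)) (x : Idx d),
      merge K (fun i => x i) (fun i => x₀ i) = K.piecewise x x₀ := by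
    intro K x
    funext i
    by_cases hi : i ∈ K <;> simp [merge, hi]
  -- Blocks are switched from `x₀` to `x` one at a time; each switch uses the minor for that block
  -- against `x₀` and contributes one factor.
  have key : ∀ s ⊆ α.parts, ∀ x : Idx d,
      ψ ((s.biUnion id).piecewise x x₀) = ψ x₀ * ∏ K ∈ s, (ψ (K.piecewise x x₀) / ψ x₀) := by
    intro s
    induction s using Finset.induction with
    | empty =>
      intro _ x
      have h0 : ((∅ : Finset (Finset (Fin n))).biUnion id).piecewise x x₀ = x₀ := by
        funext i
        simp [Finset.piecewise]
      rw [h0, Finset.prod_empty, mul_one]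
    | insert K s hK ih =>
      intro hs x
      have hsp := h K (hs (Finset.mem_insert_self K s))
        (((insert K s).biUnion id).piecewise x x₀) x₀
      have h1 : K.piecewise (((insert K s).biUnion id).piecewise x x₀) x₀ = K.piecewise x x₀ := by
        funext i
        by_cases hi : i ∈ K <;> simp [hi, Finset.piecewise]
      have h2 : K.piecewise x₀ (((insert K s).biUnion id).piecewise x x₀) =
          (s.biUnion id).piecewise x x₀ := by
        funext i
        by_cases hi : i ∈ K
        · have : i ∉ s.biUnion id := by
            intro hi'
            obtain ⟨K', hK', hiK'⟩ := Finset.mem_biUnion.1 hi'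
            have := α.eq_of_mem_parts (hs (Finset.mem_insert_self K s))
              (hs (Finset.mem_insert_of_mem hK')) hi hiK'
            exact hK (this ▸ hK')
          rw [Finset.piecewise_eq_of_mem _ _ _ hi, Finset.piecewise_eq_of_notMem _ _ _ this]
        · simp [hi, Finset.piecewise]
      rw [h1, h2, ih ((Finset.subset_insert K s).trans hs) x] at hsp
      refine mul_right_cancel₀ hx₀ ?_
      rw [Finset.prod_insert hK, hsp]
      field_simp
  funext x
  have := key α.parts subset_rfl x
  rw [α.biUnion_parts, Finset.piecewise_univ] at this
  rw [this, Pi.smul_apply, smul_eq_mul, tensorVec]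
  simp only [hmerge]

theorem proj_smul {ι : Type*} (c : ℂ) (ψ : ι → ℂ) :
    proj (c • ψ) = ((‖c‖ ^ 2 : ℝ) : ℂ) • proj ψ := by
  ext x y
  simp only [proj, Pi.smul_apply, Matrix.smul_apply, smul_eq_mul, star_mul',
    ← Complex.normSq_eq_norm_sq, ← Complex.mul_conj, starRingEnd_apply]
  ring

theorem proj_mem_pureSep_of_splits {α : Split n} {ψ : Idx d → ℂ} (hψ : IsUnitVec ψ)
    (h : ∀ K ∈ α.parts, Splits K ψ) : proj ψ ∈ pureSep d α := by
  refine ⟨⟨ψ, hψ, rfl⟩, ?_⟩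
  obtain ⟨x₀, hx₀⟩ := hψ.exists_ne_zero
  obtain ⟨c, φ, hψφ⟩ : ∃ (c : ℂ) (φ : (K : Finset (Fin n)) → SubIdx d K → ℂ),
      ψ = c • tensorVec α φ := ⟨_, _, eq_smul_tensorVec h hx₀⟩
  let N : Finset (Fin n) → ℝ := fun K => ∑ x, ‖φ K x‖ ^ 2
  have hN0 : ∀ K, 0 ≤ N K := fun K => Finset.sum_nonneg fun _ _ => by positivity
  have hnorm : ‖c‖ ^ 2 * ∏ K ∈ α.parts, N K = 1 := by
    rw [← sum_norm_tensorVec, Finset.mul_sum, ← show ∑ x, ‖ψ x‖ ^ 2 = 1 from hψ, hψφ]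
    simp only [Pi.smul_apply, norm_smul, mul_pow]
  -- The squared norms multiply to 1/‖c‖², so none is zero and every factor can be normalized; the
  -- phase of `c` disappears in `proj`.
  have hN : ∀ K ∈ α.parts, N K ≠ 0 := fun K hK h0 => by
    rw [Finset.prod_eq_zero hK h0, mul_zero] at hnorm
    exact zero_ne_one hnorm
  refine ⟨fun K x => ((Real.sqrt (N K))⁻¹ : ℂ) * φ K x, fun K hK => ?_, ?_⟩
  · unfold IsUnitVec
    simp only [norm_mul, mul_pow, ← Finset.mul_sum, norm_inv, Complex.norm_real, inv_pow,
      Real.norm_eq_abs, sq_abs, Real.sq_sqrt (hN0 K)]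
    exact inv_mul_cancel₀ (hN K hK)
  · have hscale : tensorVec α (fun K x => ((Real.sqrt (N K))⁻¹ : ℂ) * φ K x) =
        (∏ K ∈ α.parts, ((Real.sqrt (N K))⁻¹ : ℂ)) • tensorVec α φ := by
      funext x
      simp only [tensorVec, Finset.prod_mul_distrib, Pi.smul_apply, smul_eq_mul]
    rw [hscale, hψφ, proj_smul, proj_smul]
    congr 2
    rw [norm_prod, ← Finset.prod_pow]
    simp only [norm_inv, Complex.norm_real, inv_pow, Real.norm_eq_abs, sq_abs,
      Real.sq_sqrt (hN0 _), Finset.prod_inv_distrib]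
    exact eq_inv_of_mul_eq_one_left hnorm

theorem proj_mem_pureSep_iff {α : Split n} {ψ : Idx d → ℂ} (hψ : IsUnitVec ψ) :
    proj ψ ∈ pureSep d α ↔ ∀ K ∈ α.parts, Splits K ψ := by
  refine ⟨?_, proj_mem_pureSep_of_splits hψ⟩
  rintro ⟨-, φ, -, h⟩ K hK
  exact splits_of_proj_eq h (splits_tensorVec φ (subset_or_disjoint_of_le le_rfl hK))

theorem pureSep_mono {α β : Split n} (h : β ≤ α) : pureSep d β ⊆ pureSep d α := by
  rintro _ ⟨⟨ψ, hψ, rfl⟩, φ, -, hφ⟩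
  exact proj_mem_pureSep_of_splits hψ fun K hK =>
    splits_of_proj_eq hφ (splits_tensorVec φ (subset_or_disjoint_of_le h hK))

theorem pureSep_eq_iUnion_pureClass (α : Split n) :
    pureSep d α = ⋃ β ∈ {β : Split n | β ≤ α}, pureClass d β := by
  ext π
  simp only [Set.mem_iUnion, exists_prop]
  constructor
  · intro h
    -- There are finitely many partitions, so a minimal one separating `π` exists below `α`.
    obtain ⟨β, hβα, hβ⟩ := (Set.toFinite {β : Split n | π ∈ pureSep d β}).exists_le_minimal h
    exact ⟨β, hβα, hβ.1, fun γ hγ hπ => hγ.not_ge (hβ.2 hπ hγ.le)⟩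
  · rintro ⟨β, hβα, hβ, -⟩
    exact pureSep_mono hβα hβ

end Splitting

/-! ### Indicator functions -/

section Indicators

variable {n : ℕ} {d : Fin n → ℕ}

theorem psSubset_eq_convexHull {A : PSLabel n} {g : Matrix (Idx d) (Idx d) ℂ → ℝ}
    (hg : IsIndicator d A g) :
    psSubset d A = convexHull ℝ {π ∈ pureStates (Idx d) | g π = 0} := by
  unfold psSubset
  congr 1
  ext π
  constructor
  · intro h
    obtain ⟨α, -, hπ⟩ := Set.mem_iUnion₂.1 h
    exact ⟨hπ.1, (hg.2.2 π hπ.1).2 h⟩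
  · exact fun h => (hg.2.2 π h.1).1 h.2

theorem IsIndicator.convexRoof_eq_zero_iff {A : PSLabel n} {g : Matrix (Idx d) (Idx d) ℂ → ℝ}
    (hg : IsIndicator d A g) {ρ : Matrix (Idx d) (Idx d) ℂ} (hρ : ρ ∈ states (Idx d)) :
    convexRoof g ρ = 0 ↔ ρ ∈ psSubset d A := by
  rw [psSubset_eq_convexHull hg]
  exact PartialSep.convexRoof_eq_zero_iff hg.1 hg.2.1 hρ

theorem IsIndicator.convexRoof_pos_iff {A : PSLabel n} {g : Matrix (Idx d) (Idx d) ℂ → ℝ}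
    (hg : IsIndicator d A g) {ρ : Matrix (Idx d) (Idx d) ℂ} (hρ : ρ ∈ states (Idx d)) :
    0 < convexRoof g ρ ↔ ρ ∉ psSubset d A := by
  rw [← hg.convexRoof_eq_zero_iff hρ]
  exact (convexRoof_nonneg hg.2.1).lt_iff_ne'

theorem psSubset_mono {A B : PSLabel n} (h : pureSepLabel d A ⊆ pureSepLabel d B) :
    psSubset d A ⊆ psSubset d B :=
  convexHull_mono h

variable {F : (K : Finset (Fin n)) → Matrix (SubIdx d K) (SubIdx d K) ℂ → ℝ}

theorem continuousOn_indK (hF : IsMixedness d F) {K : Finset (Fin n)} (hK : K.Nonempty) :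
    ContinuousOn (indK F K) (pureStates (Idx d)) :=
  (hF K hK).1.comp (continuous_reduced K).continuousOn
    fun _ h => reduced_mem_states K (pureStates_subset_states h)

theorem indK_nonneg (hF : IsMixedness d F) {K : Finset (Fin n)} (hK : K.Nonempty)
    {π : Matrix (Idx d) (Idx d) ℂ} (hπ : π ∈ pureStates (Idx d)) : 0 ≤ indK F K π :=
  (hF K hK).2.1 _ (reduced_mem_states K (pureStates_subset_states hπ))

theorem indK_proj_eq_zero_iff (hF : IsMixedness d F) {K : Finset (Fin n)} (hK : K.Nonempty)
    {ψ : Idx d → ℂ} (hψ : IsUnitVec ψ) : indK F K (proj ψ) = 0 ↔ Splits K ψ := by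
  rw [← reduced_mem_pureStates_iff hψ]
  exact (hF K hK).2.2 _ (reduced_mem_states K (pureStates_subset_states ⟨ψ, hψ, rfl⟩))

theorem isIndicator_indSplit (hF : IsMixedness d F) (α : Split n) :
    IsIndicator d {α} (indSplit F α) := by
  refine ⟨?_, fun π hπ => ?_, ?_⟩
  · exact continuousOn_finsetSum _ fun K hK =>
      continuousOn_indK hF (α.nonempty_of_mem_parts hK)
  · exact Finset.sum_nonneg fun K hK => indK_nonneg hF (α.nonempty_of_mem_parts hK) hπ
  · rintro _ ⟨ψ, hψ, rfl⟩
    simp only [pureSepLabel, Finset.mem_singleton, Set.iUnion_iUnion_eq_left]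
    rw [proj_mem_pureSep_iff hψ, indSplit, Finset.sum_eq_zero_iff_of_nonneg fun K hK =>
      indK_nonneg hF (α.nonempty_of_mem_parts hK) ⟨ψ, hψ, rfl⟩]
    exact forall₂_congr fun K hK => indK_proj_eq_zero_iff hF (α.nonempty_of_mem_parts hK) hψ

/-- Products of indicator functions are indicator functions of the union of the labels. -/
theorem isIndicator_prod {A : PSLabel n} {f : Split n → Matrix (Idx d) (Idx d) ℂ → ℝ}
    (hf : ∀ α ∈ A, IsIndicator d {α} (f α)) : IsIndicator d A fun π => ∏ α ∈ A, f α π := by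
  refine ⟨?_, fun π hπ => ?_, fun π hπ => ?_⟩
  · exact continuousOn_finsetProd _ fun α hα => (hf α hα).1
  · exact Finset.prod_nonneg fun α hα => (hf α hα).2.1 π hπ
  -- For the empty label the product is 1 and the set of separable states is empty.
  · rw [Finset.prod_eq_zero_iff]
    simp only [pureSepLabel, Set.mem_iUnion, exists_prop]
    refine exists_congr fun α => and_congr_right fun hα => ?_
    rw [(hf α hα).2.2 π hπ]
    simp [pureSepLabel]

theorem mem_psClass_iff (hF : IsMixedness d F) (S T : Set (PSLabel n))
    {ρ : Matrix (Idx d) (Idx d) ℂ} (hρ : ρ ∈ states (Idx d)) :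
    ρ ∈ psClass d S T ↔ (∀ A ∈ S, 0 < convexRoof (indLabel F A) ρ) ∧
      ∀ B ∈ T, convexRoof (indLabel F B) ρ = 0 := by
  have hI : ∀ A : PSLabel n, IsIndicator d A (indLabel F A) := fun A =>
    isIndicator_prod fun α _ => isIndicator_indSplit hF α
  simp only [(hI _).convexRoof_pos_iff hρ, (hI _).convexRoof_eq_zero_iff hρ]
  exact and_iff_right hρ

end Indicators

/-! ### Three parties -/

section Tripartite

variable {d : Fin 3 → ℕ}

/-- The blocks of a|bc are complementary, so splitting along one is splitting along the other and
one reduced state suffices. -/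
theorem isIndicator_triInd_bi {F : (K : Finset (Fin 3)) → Matrix (SubIdx d K) (SubIdx d K) ℂ → ℝ}
    (hF : IsMixedness d F) (a : Fin 3) : IsIndicator d {biSplit a} (indK F {a}) := by
  have ha : ({a} : Finset (Fin 3)).Nonempty := Finset.singleton_nonempty a
  refine ⟨continuousOn_indK hF ha, fun π hπ => indK_nonneg hF ha hπ, ?_⟩
  rintro _ ⟨ψ, hψ, rfl⟩
  have hcompl : ({a + 1, a + 2} : Finset (Fin 3)) = {a}ᶜ := by
    revert a; decide
  simp only [pureSepLabel, Finset.mem_singleton, Set.iUnion_iUnion_eq_left]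
  rw [proj_mem_pureSep_iff hψ, indK_proj_eq_zero_iff hF ha hψ]
  simp [biSplit, hcompl, splits_compl]

theorem biSplit_injective : Function.Injective biSplit := by
  intro a b h
  have h : ({{a}, {a + 1, a + 2}} : Finset (Finset (Fin 3))) = {{b}, {b + 1, b + 2}} :=
    congrArg Finpartition.parts h
  revert a b
  decide

theorem isIndicator_triInd {F : (K : Finset (Fin 3)) → Matrix (SubIdx d K) (SubIdx d K) ℂ → ℝ}
    (hF : IsMixedness d F) (t : TriLabel) : IsIndicator d t.label fun π => triInd F π t := by
  have hprod : ∀ s : Finset (Fin 3),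
      IsIndicator d (s.map ⟨biSplit, biSplit_injective⟩) fun π => ∏ a ∈ s, indK F {a} π := by
    intro s
    -- Factors are indexed by partitions there, so the party is recovered from its bipartition by a
    -- left inverse of `biSplit`.
    have h := isIndicator_prod (d := d) (A := s.map ⟨biSplit, biSplit_injective⟩)
      (f := fun α => indK F {Function.invFun biSplit α}) (by
        intro α hα
        obtain ⟨a, -, rfl⟩ := Finset.mem_map.1 hα
        simpa [Function.leftInverse_invFun biSplit_injective a] using isIndicator_triInd_bi hF a)
    simpa [Function.leftInverse_invFun biSplit_injective _] using h
  cases t with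
  | full =>
    have h : (fun π => triInd F π .full) = indSplit F (⊥ : Split 3) := by
      funext π
      simp [triInd, indSplit, Finpartition.parts_bot, Fin.sum_univ_three]
    exact h ▸ isIndicator_indSplit hF (⊥ : Split 3)
  | bi a => exact isIndicator_triInd_bi hF a
  | pair a =>
    have ha : a + 1 ≠ a + 2 := by revert a; decide
    simpa [TriLabel.label, triInd, Finset.prod_pair ha] using hprod {a + 1, a + 2}
  | two =>
    simpa [TriLabel.label, triInd, mul_assoc] using hprod {0, 1, 2}

theorem psSubset_top : psSubset d {⊤} = states (Idx d) := by
  rw [← convexHull_pureStates]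
  unfold psSubset
  congr 1
  simp only [pureSepLabel, Finset.mem_singleton, Set.iUnion_iUnion_eq_left]
  refine Set.Subset.antisymm (fun _ h => h.1) ?_
  rintro _ ⟨ψ, hψ, rfl⟩
  refine (proj_mem_pureSep_iff hψ).2 fun K hK => ?_
  rw [Finset.mem_singleton.1 (Finpartition.parts_top_subset _ hK)]
  exact splits_univ ψ

theorem triD_full_subset (a : Fin 3) : triD d .full ⊆ triD d (.bi a) := by
  refine psSubset_mono ?_
  simp only [pureSepLabel, TriLabel.label, Finset.mem_singleton, Set.iUnion_iUnion_eq_left]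
  exact pureSep_mono bot_le

theorem pureSepLabel_mono {A B : PSLabel 3} (h : A ⊆ B) : pureSepLabel d A ⊆ pureSepLabel d B :=
  Set.biUnion_subset_biUnion_left h

theorem triD_bi_subset_pair (a b : Fin 3) (h : a ≠ b) : triD d (.bi a) ⊆ triD d (.pair b) := by
  refine psSubset_mono (pureSepLabel_mono ?_)
  obtain rfl | rfl : a = b + 1 ∨ a = b + 2 := by revert a b; decide
  all_goals simp [TriLabel.label]

theorem triD_pair_subset_two (a : Fin 3) : triD d (.pair a) ⊆ triD d .two := by
  refine psSubset_mono (pureSepLabel_mono ?_)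
  fin_cases a <;> simp [TriLabel.label, Finset.insert_subset_iff]

theorem forall_triLabel_iff {p : TriLabel → Prop} :
    (∀ t, p t) ↔ p .full ∧ p .two ∧ (p (.bi 0) ∧ p (.bi 1) ∧ p (.bi 2)) ∧
      p (.pair 0) ∧ p (.pair 1) ∧ p (.pair 2) := by
  refine ⟨fun h => by simp [h], fun ⟨h0, h2, hb, hp⟩ t => ?_⟩
  cases t with
  | full => exact h0
  | two => exact h2
  | bi a => fin_cases a; exacts [hb.1, hb.2.1, hb.2.2]
  | pair a => fin_cases a; exacts [hp.1, hp.2.1, hp.2.2]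

/-- Each class is written with only the conditions it needs; the inclusions among the PS subsets
force the remaining columns of its row. -/
theorem mem_triClass_iff (c : TriClass) {ρ : Matrix (Idx d) (Idx d) ℂ}
    (hρ : ρ ∈ states (Idx d)) :
    ρ ∈ triClass d c ↔ ∀ t : TriLabel, triTable c t ↔ ρ ∈ triD d t := by
  have h0 := fun a => @triD_full_subset d a ρ
  have h1 := fun a b h => @triD_bi_subset_pair d a b h ρ
  have h2 := fun a => @triD_pair_subset_two d a ρ
  have htop : ρ ∈ psSubset d {⊤} := psSubset_top ▸ hρ
  rw [forall_triLabel_iff]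
  simp [Fin.forall_fin_succ] at h0 h1 h2
  cases c with
  | c3 => simp [triClass, triTable]; grind
  | c28 => simp [triClass, triTable]; grind
  | c24 => simp [triClass, triTable]; grind
  | c21 => simp [triClass, triTable]; grind
  | c1 => simp [triClass, triTable, htop]; grind
  | c27 a => fin_cases a <;> simp [triClass, triTable] <;> grind
  | c26 a => fin_cases a <;> simp [triClass, triTable] <;> grind
  | c25 a => fin_cases a <;> simp [triClass, triTable] <;> grind
  | c23 a => fin_cases a <;> simp [triClass, triTable] <;> grind
  | c22 a => fin_cases a <;> simp [triClass, triTable] <;> grind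

theorem triTable_injective {c c' : TriClass} (h : ∀ t, triTable c t ↔ triTable c' t) :
    c = c' := by
  rw [forall_triLabel_iff] at h
  cases c <;> cases c' <;> simp [triTable] at h ⊢ <;> omega

/-- Outside D_0 and inside D_2, the number of R's containing `ρ` decides. None gives `c21`. Exactly
R_a excludes every B, giving `c22 a`. All but R_a allows only B_a, giving `c25 a` or `c23 a`. If all
three contain `ρ`, having 0, 1, 2 or 3 of the B's gives `c24`, `c26`, `c27` or `c28`. -/
theorem exists_mem_triClass {ρ : Matrix (Idx d) (Idx d) ℂ} (hρ : ρ ∈ states (Idx d)) :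
    ∃ c, ρ ∈ triClass d c := by
  have htop : ρ ∈ psSubset d {⊤} := psSubset_top ▸ hρ
  by_contra! h
  have h27 := fun a => h (.c27 a)
  have h26 := fun a => h (.c26 a)
  have h25 := fun a => h (.c25 a)
  have h23 := fun a => h (.c23 a)
  have h22 := fun a => h (.c22 a)
  have h3 := h .c3
  have h28 := h .c28
  have h24 := h .c24
  have h21 := h .c21
  have h1 := h .c1
  clear h
  have hbp := fun a b h => @triD_bi_subset_pair d a b h ρ
  simp [triClass, Fin.forall_fin_succ, htop] at hbp h27 h26 h25 h23 h22 h3 h28 h24 h21 h1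
  grind (splitImp := true)

theorem existsUnique_mem_triClass {ρ : Matrix (Idx d) (Idx d) ℂ} (hρ : ρ ∈ states (Idx d)) :
    ∃! c, ρ ∈ triClass d c := by
  refine existsUnique_of_exists_of_unique (exists_mem_triClass hρ) fun c c' hc hc' => ?_
  rw [mem_triClass_iff _ hρ] at hc hc'
  exact triTable_injective fun t => (hc t).trans (hc' t).symm

end Tripartite
end PartialSep

theorem mainTheorem1 :
    -- pure PS subsets as unions of pure PS classes
    (∀ (n : ℕ) (d : Fin n → ℕ) (α : Split n),
      pureSep d α = ⋃ β ∈ {β : Split n | β ≤ α}, pureClass d β) ∧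
    -- the functions built from `F`: indicator properties, PS subsets, PS classes
    (∀ (n : ℕ) (d : Fin n → ℕ)
      (F : (K : Finset (Fin n)) → Matrix (SubIdx d K) (SubIdx d K) ℂ → ℝ),
      IsMixedness d F →
      (∀ α : Split n, IsIndicator d {α} (indSplit F α)) ∧
      (∀ A : PSLabel n, IsIndicator d A (indLabel F A)) ∧
      (∀ A : PSLabel n, ∀ ρ ∈ states (Idx d),
        IsLeast (roofValues (indLabel F A) ρ) (convexRoof (indLabel F A) ρ) ∧
        (convexRoof (indLabel F A) ρ = 0 ↔ ρ ∈ psSubset d A)) ∧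
      (∀ S T : Set (PSLabel n), ∀ ρ ∈ states (Idx d),
        (ρ ∈ psClass d S T ↔
          (∀ A ∈ S, 0 < convexRoof (indLabel F A) ρ) ∧
          (∀ B ∈ T, convexRoof (indLabel F B) ρ = 0)))) ∧
    -- arbitrary indicator functions
    (∀ (n : ℕ) (d : Fin n → ℕ) (A : PSLabel n) (g : Matrix (Idx d) (Idx d) ℂ → ℝ),
      IsIndicator d A g → ∀ ρ ∈ states (Idx d),
        IsLeast (roofValues g ρ) (convexRoof g ρ) ∧
        (convexRoof g ρ = 0 ↔ ρ ∈ psSubset d A)) ∧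
    -- three parties: the special indicator functions
    (∀ (d : Fin 3 → ℕ)
      (F : (K : Finset (Fin 3)) → Matrix (SubIdx d K) (SubIdx d K) ℂ → ℝ),
      IsMixedness d F →
      ∀ t : TriLabel, IsIndicator d t.label (fun π => triInd F π t)) ∧
    -- three parties: the twenty classes and their two tables
    (∀ (d : Fin 3 → ℕ), ∀ ρ ∈ states (Idx d),
      (∃! c : TriClass, ρ ∈ triClass d c) ∧
      ∀ c : TriClass,
        (ρ ∈ triClass d c ↔
          ρ ∈ psSubset d {⊤} ∧
          ∀ t : TriLabel, (triTable c t → ρ ∈ triD d t) ∧ (¬ triTable c t → ρ ∉ triD d t)) ∧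
        ∀ g : TriLabel → Matrix (Idx d) (Idx d) ℂ → ℝ,
          (∀ t, IsIndicator d t.label (g t)) →
          (ρ ∈ triClass d c ↔
            ∀ t : TriLabel, (triTable c t → convexRoof (g t) ρ = 0) ∧
              (¬ triTable c t → 0 < convexRoof (g t) ρ))) := by
  refine ⟨fun n d α => pureSep_eq_iUnion_pureClass α, fun n d F hF => ?_, fun n d A g hg ρ hρ =>
    ⟨isLeast_convexRoof hg.1 hρ, hg.convexRoof_eq_zero_iff hρ⟩,
    fun d F hF t => isIndicator_triInd hF t,
    fun d ρ hρ => ⟨existsUnique_mem_triClass hρ, fun c => ?_⟩⟩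
  · have hI : ∀ A : PSLabel n, IsIndicator d A (indLabel F A) := fun A =>
      isIndicator_prod fun α _ => isIndicator_indSplit hF α
    exact ⟨isIndicator_indSplit hF, hI, fun A ρ hρ =>
      ⟨isLeast_convexRoof (hI A).1 hρ, (hI A).convexRoof_eq_zero_iff hρ⟩,
      fun S T ρ hρ => mem_psClass_iff hF S T hρ⟩
  · have hrow : ρ ∈ triClass d c ↔
        ∀ t, (triTable c t → ρ ∈ triD d t) ∧ (¬ triTable c t → ρ ∉ triD d t) := by
      rw [mem_triClass_iff c hρ]
      exact forall_congr' fun t => by tauto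
    -- D_1 is the set of all states, so membership in it adds no condition.
    refine ⟨hrow.trans (and_iff_right (psSubset_top ▸ hρ)).symm, fun g hg => hrow.trans ?_⟩
    simp only [(hg _).convexRoof_eq_zero_iff hρ, (hg _).convexRoof_pos_iff hρ, triD]
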